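/- Let $E$ be a (real) Banach lattice with norm dual $E'$, which is a Banach lattice under the order $f\le g\iff f(z)\le g(z)$ for all $z\in E_+$. For $x\in E$ let $\mathscr F_x:E'\to\mathbb R$, $\mathscr F_x(f)=f(x)$, be the evaluation functional. In a Banach lattice $X$, a net $(x_\alpha)$ converges in order to $a$ if there is a net $(y_\beta)$, possibly over another index set, with $y_\beta\downarrow 0$ such that for every $\beta$ there is $\alpha_0$ with $|x_\alpha-a|\le y_\beta$ for all $\alpha\ge\alpha_0$. A net $(x_\alpha)$ in $X$ is $uo$-null (resp. $un$-null, $uaw$-null) if for every $u\in X_+$ the net $(|x_\alpha|\wedge u)$ converges to $0$ in order (resp. in norm, weakly). A net $(f_\alpha)$ in $E'$ is $uaw^*$-null if $|f_\alpha|\wedge u'\to0$ in the weak$^*$ topology $\sigma(E',E)$ for every $u'\in E'_+$. A net is disjoint if $|x_\alpha|\wedge|x_\beta|=0$ whenever $\alpha\neq\beta$. For a Banach lattice $X$, $X^\sim_{uo}$ is the set of linear functionals $\varphi$ on $X$ with $\varphi(x_\alpha)\to0$ for every norm bounded $uo$-null net in $X$; $X^\sim_{un}$ and $X^\sim_{uaw}$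 are the sets of bounded linear functionals with the same property for norm bounded $un$-null, respectively $uaw$-null, nets; $X^\sim_{d}$ is the set of bounded linear functionals $\varphi$ with $\varphi(x_\alpha)\to0$ for every norm bounded disjoint net in $X$ whose index set has no greatest element; and $(E')^\sim_{uaw^*}$ is the set of bounded linear functionals $\varphi$ on $E'$ with $\varphi(f_\alpha)\to0$ for every norm bounded $uaw^*$-null net in $E'$. Then, for every $x\in E$, the following conditions are equivalent. 1. $\mathscr F_x\in(E')^\sim_{uaw^*}$. 2. $\mathscr F_x(f_n)\to0$ for every norm bounded $uaw^*$-null sequence $(f_n)$ in $E'$. 3. $\mathscr F_x\in(E')^\sim_{uo}$. 4. $\mathscr F_x(f_n)\to0$ for every norm bounded $uo$-null sequence $(f_n)$ in $E'$. 5. $\mathscr F_x\in(E')^\sim_{uaw}$. 6. $\mathscr F_x(f_n)\to0$ for every norm bounded $uaw$-null sequence $(f_n)$ in $E'$. 7. $\mathscr F_x\in(E')^\sim_{d}$. 8. $\mathscr F_x(f_n)\to0$ for every norm bounded disjoint sequence $(f_n)$ in $E'$. 9. Every disjoint sequence in $[0,|x|]$ converges to zero in norm. If, in addition, $E'$ has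 order continuous norm (that is, $\|f_\alpha\|\to0$ for every net $f_\alpha\downarrow0$ in $E'$), these conditions are also equivalent to each of 10. $\mathscr F_x\in(E')^\sim_{un}$. 11. $\mathscr F_x(f_n)\to0$ for every norm bounded $un$-null sequence $(f_n)$ in $E'$. -/

import Mathlib

open Filter Topology Set

universe u v

set_option linter.unusedSectionVars false

section DualLattice

variable {E : Type u} [NormedAddCommGroup E] [NormedSpace ℝ E] [Lattice E]
  [IsOrderedAddMonoid E] [HasSolidNorm E] [IsOrderedModule ℝ E]

/-- The canonical order of the norm dual `E'`: `f ≤ g` iff `f x ≤ g x` for all `x ≥ 0`. -/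
instance StrongDual.instPartialOrderOfBanachLattice : PartialOrder (StrongDual ℝ E) where
  le f g := ∀ x : E, 0 ≤ x → f x ≤ g x
  le_refl _ _ _ := le_rfl
  le_trans _ _ _ h₁ h₂ x hx := (h₁ x hx).trans (h₂ x hx)
  le_antisymm f g h₁ h₂ := by
    have key : ∀ y : E, 0 ≤ y → f y = g y := fun y hy => le_antisymm (h₁ y hy) (h₂ y hy)
    ext x
    rw [← posPart_sub_negPart x, map_sub, map_sub, key _ (posPart_nonneg x),
      key _ (negPart_nonneg x)]

theorem StrongDual.le_iff_forall_nonneg {f g : StrongDual ℝ E} :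
    f ≤ g ↔ ∀ x : E, 0 ≤ x → f x ≤ g x := Iff.rfl

/-- The Riesz-Kantorovich formula for the positive part of `f`, at a vector `x ≥ 0`:
the supremum of `f y` over `0 ≤ y ≤ x`. -/
noncomputable def rieszKantorovich (f : StrongDual ℝ E) (x : E) : ℝ := sSup (f '' Icc 0 x)

theorem norm_le_norm_of_nonneg_of_le {y x : E} (hy : 0 ≤ y) (h : y ≤ x) : ‖y‖ ≤ ‖x‖ := by
  apply norm_le_norm_of_abs_le_abs
  rwa [abs_of_nonneg hy, abs_of_nonneg (hy.trans h)]

theorem apply_le_of_mem_Icc (f : StrongDual ℝ E) {x y : E} (hy : y ∈ Icc 0 x) :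
    f y ≤ ‖f‖ * ‖x‖ :=
  (le_abs_self _).trans ((f.le_opNorm y).trans
    (mul_le_mul_of_nonneg_left (norm_le_norm_of_nonneg_of_le hy.1 hy.2) (norm_nonneg f)))

theorem rieszKantorovich_bddAbove (f : StrongDual ℝ E) (x : E) : BddAbove (f '' Icc 0 x) := by
  refine ⟨‖f‖ * ‖x‖, ?_⟩
  rintro _ ⟨y, hy, rfl⟩
  exact apply_le_of_mem_Icc f hy

theorem le_rieszKantorovich (f : StrongDual ℝ E) {x y : E} (hy : y ∈ Icc 0 x) :
    f y ≤ rieszKantorovich f x :=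
  le_csSup (rieszKantorovich_bddAbove f x) (mem_image_of_mem f hy)

theorem rieszKantorovich_le (f : StrongDual ℝ E) {x : E} (hx : 0 ≤ x) {c : ℝ}
    (h : ∀ y ∈ Icc 0 x, f y ≤ c) : rieszKantorovich f x ≤ c := by
  refine csSup_le ⟨f 0, mem_image_of_mem f ⟨le_rfl, hx⟩⟩ ?_
  rintro _ ⟨y, hy, rfl⟩
  exact h y hy

theorem rieszKantorovich_nonneg (f : StrongDual ℝ E) {x : E} (hx : 0 ≤ x) :
    0 ≤ rieszKantorovich f x := by
  simpa using le_rieszKantorovich f (x := x) (y := 0) ⟨le_rfl, hx⟩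

theorem rieszKantorovich_add (f : StrongDual ℝ E) {x y : E} (hx : 0 ≤ x) (hy : 0 ≤ y) :
    rieszKantorovich f (x + y) = rieszKantorovich f x + rieszKantorovich f y := by
  apply le_antisymm
  · refine rieszKantorovich_le f (add_nonneg hx hy) fun z hz => ?_
    have h1 : f (z ⊓ x) ≤ rieszKantorovich f x :=
      le_rieszKantorovich f ⟨le_inf hz.1 hx, inf_le_right⟩
    have h2 : f (z - z ⊓ x) ≤ rieszKantorovich f y := by
      refine le_rieszKantorovich f ⟨sub_nonneg.2 inf_le_left, ?_⟩
      rw [sub_le_comm]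
      refine le_inf (sub_le_self _ hy) ?_
      rw [sub_le_iff_le_add]
      exact hz.2
    have h3 : f z = f (z ⊓ x) + f (z - z ⊓ x) := by rw [← map_add]; congr 1; abel
    linarith
  · have h : ∀ a ∈ Icc 0 x, f a ≤ rieszKantorovich f (x + y) - rieszKantorovich f y := by
      intro a ha
      rw [le_sub_comm]
      refine rieszKantorovich_le f hy fun b hb => ?_
      have := le_rieszKantorovich f (x := x + y) (y := a + b)
        ⟨add_nonneg ha.1 hb.1, add_le_add ha.2 hb.2⟩
      rw [map_add] at this
      linarith
    linarith [rieszKantorovich_le f hx h]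

theorem rieszKantorovich_smul_le (f : StrongDual ℝ E) {c : ℝ} (hc : 0 < c) {x : E} (hx : 0 ≤ x) :
    rieszKantorovich f (c • x) ≤ c * rieszKantorovich f x := by
  refine rieszKantorovich_le f (smul_nonneg hc.le hx) fun z hz => ?_
  have h := le_rieszKantorovich f (x := x) (y := c⁻¹ • z)
    ⟨smul_nonneg (inv_nonneg.2 hc.le) hz.1, by
      have := smul_le_smul_of_nonneg_left hz.2 (inv_nonneg.2 hc.le)
      rwa [smul_smul, inv_mul_cancel₀ hc.ne', one_smul] at this⟩
  rw [map_smul, smul_eq_mul, inv_mul_le_iff₀ hc] at h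
  exact h

theorem rieszKantorovich_smul (f : StrongDual ℝ E) {c : ℝ} (hc : 0 ≤ c) {x : E} (hx : 0 ≤ x) :
    rieszKantorovich f (c • x) = c * rieszKantorovich f x := by
  rcases hc.eq_or_lt with rfl | hc
  · simp [rieszKantorovich]
  · refine le_antisymm (rieszKantorovich_smul_le f hc hx) ?_
    have h := rieszKantorovich_smul_le f (inv_pos.2 hc) (smul_nonneg hc.le hx)
    rw [smul_smul, inv_mul_cancel₀ hc.ne', one_smul] at h
    rwa [← le_inv_mul_iff₀ hc]

theorem rieszKantorovich_sub_eq (f : StrongDual ℝ E) {a b c d : E} (ha : 0 ≤ a) (hb : 0 ≤ b)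
    (hc : 0 ≤ c) (hd : 0 ≤ d) (h : a - b = c - d) :
    rieszKantorovich f a - rieszKantorovich f b = rieszKantorovich f c - rieszKantorovich f d := by
  have h' : a + d = c + b := sub_eq_sub_iff_add_eq_add.1 h
  have := congrArg (rieszKantorovich f) h'
  rw [rieszKantorovich_add f ha hd, rieszKantorovich_add f hc hb] at this
  linarith

/-- The positive part of a continuous functional: the unique linear extension of the
Riesz-Kantorovich formula from the positive cone to `E`. -/
noncomputable def StrongDual.rkPosPart (f : StrongDual ℝ E) : StrongDual ℝ E :=
  LinearMap.mkContinuous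
    { toFun := fun x => rieszKantorovich f x⁺ - rieszKantorovich f x⁻
      map_add' := fun x y => by
        rw [rieszKantorovich_sub_eq f (posPart_nonneg _) (negPart_nonneg _)
          (add_nonneg (posPart_nonneg x) (posPart_nonneg y))
          (add_nonneg (negPart_nonneg x) (negPart_nonneg y))
          (by rw [posPart_sub_negPart, add_sub_add_comm, posPart_sub_negPart, posPart_sub_negPart]),
          rieszKantorovich_add f (posPart_nonneg x) (posPart_nonneg y),
          rieszKantorovich_add f (negPart_nonneg x) (negPart_nonneg y)]
        ring
      map_smul' := fun c x => by
        rcases le_total 0 c with hc | hc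
        · rw [rieszKantorovich_sub_eq f (posPart_nonneg _) (negPart_nonneg _)
            (smul_nonneg hc (posPart_nonneg x)) (smul_nonneg hc (negPart_nonneg x))
            (by rw [posPart_sub_negPart, ← smul_sub, posPart_sub_negPart]),
            rieszKantorovich_smul f hc (posPart_nonneg x),
            rieszKantorovich_smul f hc (negPart_nonneg x)]
          simp only [RingHom.id_apply, smul_eq_mul]
          ring
        · have hc' : 0 ≤ -c := neg_nonneg.2 hc
          rw [rieszKantorovich_sub_eq f (posPart_nonneg _) (negPart_nonneg _)
            (smul_nonneg hc' (negPart_nonneg x)) (smul_nonneg hc' (posPart_nonneg x))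
            (by rw [posPart_sub_negPart, ← smul_sub, neg_smul, ← smul_neg, neg_sub,
              posPart_sub_negPart]),
            rieszKantorovich_smul f hc' (posPart_nonneg x),
            rieszKantorovich_smul f hc' (negPart_nonneg x)]
          simp only [RingHom.id_apply, smul_eq_mul]
          ring }
    ‖f‖ (fun x => by
      have key : ∀ y : E, 0 ≤ y → y ≤ |x| → rieszKantorovich f y ≤ ‖f‖ * ‖x‖ := by
        intro y hy hyx
        refine rieszKantorovich_le f hy fun z hz => ?_
        have := apply_le_of_mem_Icc f (x := |x|) (y := z) ⟨hz.1, hz.2.trans hyx⟩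
        rwa [norm_abs_eq_norm] at this
      have hp : x⁺ ≤ |x| := by
        rw [← posPart_add_negPart]; exact le_add_of_nonneg_right (negPart_nonneg x)
      have hn : x⁻ ≤ |x| := by
        rw [← posPart_add_negPart]; exact le_add_of_nonneg_left (posPart_nonneg x)
      change |rieszKantorovich f x⁺ - rieszKantorovich f x⁻| ≤ _
      have h1 := key _ (posPart_nonneg x) hp
      have h2 := key _ (negPart_nonneg x) hn
      have h3 := rieszKantorovich_nonneg f (posPart_nonneg x)
      have h4 := rieszKantorovich_nonneg f (negPart_nonneg x)
      rw [abs_le]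
      constructor <;> linarith)

theorem StrongDual.rkPosPart_apply (f : StrongDual ℝ E) {x : E} (hx : 0 ≤ x) :
    f.rkPosPart x = sSup (f '' Icc 0 x) := by
  change rieszKantorovich f x⁺ - rieszKantorovich f x⁻ = rieszKantorovich f x
  rw [posPart_of_nonneg hx, negPart_of_nonneg hx]
  simp [rieszKantorovich]

/-- The norm dual of a Banach lattice is a lattice; the supremum is `f ⊔ g = g + (f - g)⁺`. -/
noncomputable instance StrongDual.instLatticeOfBanachLattice : Lattice (StrongDual ℝ E) where
  __ := StrongDual.instPartialOrderOfBanachLattice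
  sup f g := g + (f - g).rkPosPart
  inf f g := f - (f - g).rkPosPart
  le_sup_left f g x hx := by
    have := le_rieszKantorovich (f - g) (x := x) (y := x) ⟨hx, le_rfl⟩
    change f x ≤ g x + (f - g).rkPosPart x
    rw [rkPosPart_apply _ hx]
    change f x - g x ≤ _ at this
    change _ ≤ g x + rieszKantorovich (f - g) x
    linarith
  le_sup_right f g x hx := by
    have := rieszKantorovich_nonneg (f - g) hx
    change g x ≤ g x + (f - g).rkPosPart x
    rw [rkPosPart_apply _ hx]
    change _ ≤ g x + rieszKantorovich (f - g) x
    linarith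
  sup_le f g h hf hg x hx := by
    change g x + (f - g).rkPosPart x ≤ h x
    rw [rkPosPart_apply _ hx]
    have : rieszKantorovich (f - g) x ≤ h x - g x := by
      refine rieszKantorovich_le _ hx fun y hy => ?_
      have h1 := hf y hy.1
      have h2 := hg (x - y) (sub_nonneg.2 hy.2)
      rw [map_sub, map_sub] at h2
      change f y - g y ≤ _
      linarith
    change g x + rieszKantorovich (f - g) x ≤ _
    linarith
  inf_le_left f g x hx := by
    have := rieszKantorovich_nonneg (f - g) hx
    change f x - (f - g).rkPosPart x ≤ f x
    rw [rkPosPart_apply _ hx]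
    change f x - rieszKantorovich (f - g) x ≤ _
    linarith
  inf_le_right f g x hx := by
    have := le_rieszKantorovich (f - g) (x := x) (y := x) ⟨hx, le_rfl⟩
    change f x - (f - g).rkPosPart x ≤ g x
    rw [rkPosPart_apply _ hx]
    change f x - g x ≤ _ at this
    change f x - rieszKantorovich (f - g) x ≤ _
    linarith
  le_inf h f g hf hg x hx := by
    change h x ≤ f x - (f - g).rkPosPart x
    rw [rkPosPart_apply _ hx]
    have : rieszKantorovich (f - g) x ≤ f x - h x := by
      refine rieszKantorovich_le _ hx fun y hy => ?_
      have h1 := hg y hy.1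
      have h2 := hf (x - y) (sub_nonneg.2 hy.2)
      rw [map_sub, map_sub] at h2
      change f y - g y ≤ _
      linarith
    change _ ≤ f x - rieszKantorovich (f - g) x
    linarith

instance StrongDual.instIsOrderedAddMonoidOfBanachLattice :
    IsOrderedAddMonoid (StrongDual ℝ E) where
  add_le_add_left f g h k x hx := by
    change f x + k x ≤ g x + k x
    linarith [h x hx]

instance StrongDual.instIsOrderedModuleOfBanachLattice : IsOrderedModule ℝ (StrongDual ℝ E) where
  smul_le_smul_of_nonneg_left _ hc _ _ h x hx := mul_le_mul_of_nonneg_left (h x hx) hc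
  smul_le_smul_of_nonneg_right _ hf _ _ h x hx := mul_le_mul_of_nonneg_right h (hf x hx)

theorem StrongDual.abs_apply_le_of_nonneg (g : StrongDual ℝ E) {y : E} (hy : 0 ≤ y) :
    |g| y ≤ ‖g‖ * ‖y‖ := by
  change -g y + (g - -g).rkPosPart y ≤ _
  rw [rkPosPart_apply _ hy]
  have : rieszKantorovich (g - -g) y ≤ ‖g‖ * ‖y‖ + g y := by
    refine rieszKantorovich_le _ hy fun z hz => ?_
    change g z - -g z ≤ _
    have h1 : g (z + z - y) ≤ ‖g‖ * ‖y‖ := by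
      refine (le_abs_self _).trans ((g.le_opNorm _).trans
        (mul_le_mul_of_nonneg_left ?_ (norm_nonneg g)))
      apply norm_le_norm_of_abs_le_abs
      rw [abs_of_nonneg hy, abs_le']
      refine ⟨?_, ?_⟩
      · rw [sub_le_iff_le_add]
        exact add_le_add hz.2 hz.2
      · rw [neg_sub]
        exact sub_le_self _ (add_nonneg hz.1 hz.1)
    rw [map_sub, map_add] at h1
    linarith
  change -g y + rieszKantorovich (g - -g) y ≤ _
  linarith

theorem StrongDual.apply_le_abs_apply_abs (f : StrongDual ℝ E) (x : E) : f x ≤ |f| |x| := by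
  have h1 : f x⁺ ≤ |f| x⁺ := le_abs_self f _ (posPart_nonneg x)
  have h2 : -f x⁻ ≤ |f| x⁻ := neg_le_abs f _ (negPart_nonneg x)
  rw [← posPart_add_negPart x, map_add]
  nth_rw 1 [← posPart_sub_negPart x]
  rw [map_sub]
  linarith

/-- The operator norm of the dual is a lattice norm, so the norm dual of a Banach lattice is a
Banach lattice. -/
instance StrongDual.instHasSolidNormOfBanachLattice : HasSolidNorm (StrongDual ℝ E) where
  solid f g h := by
    have key : ∀ x : E, f x ≤ ‖g‖ * ‖x‖ := fun x =>
      (apply_le_abs_apply_abs f x).trans ((h _ (abs_nonneg x)).trans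
        ((abs_apply_le_of_nonneg g (abs_nonneg x)).trans (by rw [norm_abs_eq_norm])))
    refine f.opNorm_le_bound (norm_nonneg g) fun x => ?_
    rw [Real.norm_eq_abs, abs_le]
    refine ⟨?_, key x⟩
    have := key (-x)
    rw [map_neg, norm_neg] at this
    linarith

end DualLattice

section Convergence

/-- The family `x` is (pairwise) disjoint. -/
def IsDisjointFamily {X : Type u} [Lattice X] [AddCommGroup X] {ι : Type v} (x : ι → X) : Prop :=
  Pairwise fun i j => |x i| ⊓ |x j| = 0

/-- The net `x` converges in order to `a`: there is a net `y ↓ 0`, possibly over another index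
set, such that for each `b` eventually `|x i - a| ≤ y b`. (Index sets for `y` in the universe of
`X` suffice, since `y` may be replaced by its range.) -/
def OrderConverges {X : Type u} [Lattice X] [AddCommGroup X] {ι : Type v} [Preorder ι]
    (x : ι → X) (a : X) : Prop :=
  ∃ (β : Type u) (_ : Preorder β) (_ : IsDirectedOrder β) (_ : Nonempty β) (y : β → X),
    Antitone y ∧ IsGLB (range y) 0 ∧ ∀ b : β, ∃ i₀ : ι, ∀ i, i₀ ≤ i → |x i - a| ≤ y b

/-- Unbounded order convergence. -/
def UoConverges {X : Type u} [Lattice X] [AddCommGroup X] {ι : Type v} [Preorder ι]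
    (x : ι → X) (a : X) : Prop :=
  ∀ w : X, 0 ≤ w → OrderConverges (fun i => |x i - a| ⊓ w) 0

/-- Unbounded norm convergence. -/
def UnConverges {X : Type u} [NormedAddCommGroup X] [Lattice X] {ι : Type v} [Preorder ι]
    (x : ι → X) (a : X) : Prop :=
  ∀ w : X, 0 ≤ w → Tendsto (fun i => |x i - a| ⊓ w) atTop (𝓝 0)

/-- Unbounded absolute weak convergence. -/
def UawConverges {X : Type u} [NormedAddCommGroup X] [NormedSpace ℝ X] [Lattice X]
    {ι : Type v} [Preorder ι] (x : ι → X) (a : X) : Prop :=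
  ∀ w : X, 0 ≤ w → Tendsto (fun i => toWeakSpace ℝ X (|x i - a| ⊓ w)) atTop (𝓝 0)

/-- Unbounded absolute weak* convergence in the dual of a Banach lattice. -/
def UawStarConverges {E : Type u} [NormedAddCommGroup E] [NormedSpace ℝ E] [Lattice E]
    [IsOrderedAddMonoid E] [HasSolidNorm E] [IsOrderedModule ℝ E]
    {ι : Type v} [Preorder ι] (x : ι → StrongDual ℝ E) (a : StrongDual ℝ E) : Prop :=
  ∀ w : StrongDual ℝ E, 0 ≤ w →
    Tendsto (fun i => StrongDual.toWeakDual (|x i - a| ⊓ w)) atTop (𝓝 0)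

/-- The family `x` is norm bounded. -/
def IsNormBoundedFamily {X : Type u} [NormedAddCommGroup X] {ι : Type v} (x : ι → X) : Prop :=
  ∃ C : ℝ, ∀ i, ‖x i‖ ≤ C

/-- The norm of `X` is order continuous: `‖x i‖ → 0` for every net `x ↓ 0`. (Index sets in the
universe of `X` suffice, since a decreasing net may be replaced by its range.) -/
def OrderContinuousNorm (X : Type u) [NormedAddCommGroup X] [Lattice X] : Prop :=
  ∀ (ι : Type u) [Preorder ι] [IsDirectedOrder ι] [Nonempty ι] (x : ι → X),
    Antitone x → IsGLB (range x) 0 → Tendsto (fun i => ‖x i‖) atTop (𝓝 0)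

end Convergence

section UnboundedDuals

variable (X : Type u) [NormedAddCommGroup X] [NormedSpace ℝ X] [Lattice X]

/-- The uo-dual: linear functionals that are continuous along norm bounded uo-null nets. -/
def uoDual : Set (X →ₗ[ℝ] ℝ) :=
  {f | ∀ (ι : Type v) [Preorder ι] [IsDirectedOrder ι] [Nonempty ι] (x : ι → X),
    IsNormBoundedFamily x → UoConverges x 0 → Tendsto (fun i => f (x i)) atTop (𝓝 0)}

/-- The un-dual: bounded functionals that are continuous along norm bounded un-null nets. -/
def unDual : Set (StrongDual ℝ X) :=
  {f | ∀ (ι : Type v) [Preorder ι] [IsDirectedOrder ι] [Nonempty ι] (x : ι → X),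
    IsNormBoundedFamily x → UnConverges x 0 → Tendsto (fun i => f (x i)) atTop (𝓝 0)}

/-- The uaw-dual: bounded functionals that are continuous along norm bounded uaw-null nets. -/
def uawDual : Set (StrongDual ℝ X) :=
  {f | ∀ (ι : Type v) [Preorder ι] [IsDirectedOrder ι] [Nonempty ι] (x : ι → X),
    IsNormBoundedFamily x → UawConverges x 0 → Tendsto (fun i => f (x i)) atTop (𝓝 0)}

/-- The d-dual: bounded functionals `f` with `f (x i) → 0` for every norm bounded disjoint net.
The index set has no greatest element (a disjoint net over `{*}` is an arbitrary vector, so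
without this only `f = 0` would qualify). -/
def disjointDual : Set (StrongDual ℝ X) :=
  {f | ∀ (ι : Type v) [Preorder ι] [IsDirectedOrder ι] [Nonempty ι] [NoMaxOrder ι] (x : ι → X),
    IsNormBoundedFamily x → IsDisjointFamily x → Tendsto (fun i => f (x i)) atTop (𝓝 0)}

end UnboundedDuals

/-- The uaw*-dual of `E`: bounded functionals on the dual of `E` that are continuous along norm
bounded uaw*-null nets. -/
def uawStarDual (E : Type u) [NormedAddCommGroup E] [NormedSpace ℝ E] [Lattice E]
    [IsOrderedAddMonoid E] [HasSolidNorm E] [IsOrderedModule ℝ E] :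
    Set (StrongDual ℝ (StrongDual ℝ E)) :=
  {φ | ∀ (ι : Type v) [Preorder ι] [IsDirectedOrder ι] [Nonempty ι] (x : ι → StrongDual ℝ E),
    IsNormBoundedFamily x → UawStarConverges x 0 → Tendsto (fun i => φ (x i)) atTop (𝓝 0)}

/-- The evaluation functional `f ↦ f x` on the dual of `E`. -/
noncomputable abbrev evalFunctional {E : Type u} [NormedAddCommGroup E] [NormedSpace ℝ E] (x : E) :
    StrongDual ℝ (StrongDual ℝ E) :=
  NormedSpace.inclusionInDoubleDual ℝ E x

/-!
Write `e = |x|`, and call `x` *good* if disjoint sequences in `[0, e]` are norm null. The theorem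
says that evaluation at `x` is continuous for any of the unbounded convergences of the dual
exactly when `x` is good. All these convergences lie between two extremes: a disjoint sequence of
functionals is uo-null and uaw-null (`IsDisjointFamily.uoConverges`,
`IsDisjointFamily.uawConverges`), and uo-, un- and uaw-null nets of functionals are uaw*-null. For
uo-null nets this holds because a net of functionals decreasing to `0` does so pointwise
(`tendsto_apply_of_antitone_of_isGLB`). If the dual has order continuous norm, uo-null nets are
un-null, so the un-versions fit in between as well. Two implications therefore carry the proof.

*If `x` is good, evaluation at `x` is continuous along bounded uaw*-null nets*
(`tendsto_apply_of_uawStarConverges`). It suffices that the positive functionals of norm at most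
`C` lie, up to an error `ε` uniform on `[0, e]`, in a single order interval `[0, g]` of the dual:
in `|f| = |f| ⊓ g + (|f| - g)⁺` the first summand tends to `0` at `e` and the second is at most `ε`
there. If no such `g` exists, one finds functionals `f n` and vectors `a n ∈ [0, e]` with
`f n (a n) > ε` and with `f k (a n)` summably small in `n > k`. The decreasing sequence
`B n = sup_{m ≥ n} a m` then converges in norm to a vector annihilated by all `f k`, although
`f n (B n) > ε` (`exists_forall_apply_sub_le`). The suprema and the limit exist since monotone
sequences in `[0, e]` are Cauchy: the part of the increment `x (n + 1) - x n` across a level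
`l = (i / N) e`, that is `(x (n + 1) - l)⁺ ⊓ (l - x n)⁺`, is disjoint in `n` and hence norm null,
and the whole increment is at most `e / N` plus twice the sum of these parts over the `N` levels
(`sub_le_add_sum_levels`).

*If bounded disjoint sequences of functionals are null at `x`, then `x` is good*
(`tendsto_zero_of_forall_disjoint_functionals`). Given a disjoint sequence `y n` in `[0, x⁺]`,
positive norming functionals of the `y n` are replaced by their components
`z ↦ lim_k f (z ⊓ k • y n)` carried by `y n`. These are disjoint, have the same value at `y n`, and
vanish at `x⁻`, so their values at `x` dominate `‖y n‖`. The interval `[0, x⁻]` is treated by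
passing to `-x`, and `[0, |x|]` is contained in the sum of the two.
-/

/-! ### Disjoint sequences and monotone sequences in order intervals -/

section LatticeGroup

variable {X : Type u} [AddCommGroup X] [Lattice X] [IsOrderedAddMonoid X]

theorem inf_add_le_add_inf {a b c : X} (ha : 0 ≤ a) (hb : 0 ≤ b) (hc : 0 ≤ c) :
    c ⊓ (a + b) ≤ c ⊓ a + c ⊓ b := by
  rw [add_inf, inf_add, inf_add]
  refine le_inf (le_inf ?_ ?_) (le_inf ?_ inf_le_right)
  · exact inf_le_left.trans (le_add_of_nonneg_left hc)
  · exact inf_le_left.trans (le_add_of_nonneg_left ha)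
  · exact inf_le_left.trans (le_add_of_nonneg_right hb)

theorem inf_sum_eq_zero {ι : Type v} {g : ι → X} (hg : ∀ i, 0 ≤ g i) {c : X} (hc : 0 ≤ c)
    (s : Finset ι) (h : ∀ i ∈ s, c ⊓ g i = 0) : c ⊓ ∑ i ∈ s, g i = 0 := by
  classical
  induction s using Finset.induction_on with
  | empty => simpa using hc
  | insert a s ha ih =>
    rw [Finset.sum_insert ha]
    refine le_antisymm ?_ (le_inf hc (add_nonneg (hg a) (Finset.sum_nonneg fun i _ => hg i)))
    refine (inf_add_le_add_inf (hg a) (Finset.sum_nonneg fun i _ => hg i) hc).trans ?_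
    rw [h a (Finset.mem_insert_self a s), ih fun i hi => h i (Finset.mem_insert_of_mem hi),
      add_zero]

/-- A finite sum of disjoint positive vectors is their supremum, so it obeys their common
bounds. -/
theorem sum_le_of_pairwise_inf_eq_zero {ι : Type v} {g : ι → X} (hg : ∀ i, 0 ≤ g i)
    (hd : Pairwise fun i j => g i ⊓ g j = 0) {w : X} (hw : 0 ≤ w) (s : Finset ι)
    (h : ∀ i ∈ s, g i ≤ w) : ∑ i ∈ s, g i ≤ w := by
  classical
  induction s using Finset.induction_on with
  | empty => simpa using hw
  | insert a s ha ih =>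
    have h0 : g a ⊓ ∑ i ∈ s, g i = 0 := inf_sum_eq_zero hg (hg a) s fun i hi =>
      hd fun hai => ha (hai ▸ hi)
    rw [Finset.sum_insert ha, ← inf_add_sup, h0, zero_add]
    exact sup_le (h a (Finset.mem_insert_self a s))
      (ih fun i hi => h i (Finset.mem_insert_of_mem hi))

theorem inf_nsmul_eq_zero {z y : X} (hz : 0 ≤ z) (hy : 0 ≤ y) (h : z ⊓ y = 0) (k : ℕ) :
    z ⊓ k • y = 0 := by
  simpa using inf_sum_eq_zero (g := fun _ : ℕ => y) (fun _ => hy) hz (Finset.range k)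
    fun _ _ => h

theorem IsDisjointFamily.abs_inf {ι : Type v} {x : ι → X} (hx : IsDisjointFamily x)
    {w : X} (hw : 0 ≤ w) : Pairwise fun i j => (|x i| ⊓ w) ⊓ (|x j| ⊓ w) = 0 := fun _ _ hij =>
  le_antisymm ((inf_le_inf inf_le_left inf_le_left).trans (hx hij).le)
    (le_inf (le_inf (abs_nonneg _) hw) (le_inf (abs_nonneg _) hw))

/-- Pointwise reading: if no level `i • c` with `i < j` is crossed on the way from `t` up to `s`
by more than `D` on both sides, then `s`, cut off at height `j • c + D`, exceeds `t` by at most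
one step `c` plus `2 • D`. -/
theorem inf_nsmul_add_le {s t c D : X} (hc : 0 ≤ c) (ht : 0 ≤ t) (hD : 0 ≤ D) (j : ℕ)
    (h : ∀ i < j, (s - i • c)⁺ ⊓ (i • c - t)⁺ ≤ D) :
    s ⊓ (j • c + D) ≤ t + c + (D + D) := by
  induction j with
  | zero =>
    rw [zero_smul, zero_add]
    exact inf_le_right.trans (le_add_of_nonneg_of_le (add_nonneg ht hc)
      (le_add_of_nonneg_left hD))
  | succ j ih =>
    have ih := ih fun i hi => h i (hi.trans j.lt_succ_self)
    set P := (s - j • c)⁺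
    set Q := (j • c - t)⁺
    set d := P ⊓ Q
    have hd : d ≤ D := h j j.lt_succ_self
    set A := s ⊓ ((j + 1) • c + D)
    set B := j • c + D
    -- Both bounds on the excess are pieces of the disjoint pair `P - d`, `Q - d`.
    have h1 : A - (t + c + (D + D)) ≤ Q - d := by
      have hA : A ≤ (j + 1) • c + D := inf_le_right
      have hQ : j • c - t ≤ Q := le_posPart _
      calc A - (t + c + (D + D)) ≤ (j + 1) • c + D - (t + c + (D + D)) := sub_le_sub_right hA _
        _ = (j • c - t) - D := by rw [succ_nsmul]; abel
        _ ≤ Q - d := sub_le_sub hQ hd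
    have h2 : A - (t + c + (D + D)) ≤ P - d := by
      have hA : A ⊓ B ≤ t + c + (D + D) := (inf_le_inf_right B inf_le_left).trans ih
      refine (sub_le_sub_left hA A).trans ?_
      rw [sub_inf, sub_self]
      refine sup_le (sub_nonneg.2 inf_le_left) ?_
      calc A - B ≤ s - B := sub_le_sub_right inf_le_left _
        _ = (s - j • c) - D := by simp only [B]; abel
        _ ≤ P - d := sub_le_sub (le_posPart _) hd
    have h3 : (P - d) ⊓ (Q - d) = 0 := by
      rw [sub_eq_add_neg, sub_eq_add_neg, ← inf_add, ← sub_eq_add_neg, sub_self]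
    exact sub_nonpos.1 ((le_inf h2 h1).trans h3.le)

theorem sub_le_add_sum_levels {s t c : X} (hc : 0 ≤ c) (ht : 0 ≤ t) (N : ℕ) (hs : s ≤ N • c) :
    s - t ≤ c + ((∑ i ∈ Finset.range N, (s - i • c)⁺ ⊓ (i • c - t)⁺) +
      ∑ i ∈ Finset.range N, (s - i • c)⁺ ⊓ (i • c - t)⁺) := by
  have hn : ∀ i : ℕ, 0 ≤ (s - i • c)⁺ ⊓ (i • c - t)⁺ := fun i =>
    le_inf (posPart_nonneg _) (posPart_nonneg _)
  have h0 : 0 ≤ ∑ i ∈ Finset.range N, (s - i • c)⁺ ⊓ (i • c - t)⁺ :=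
    Finset.sum_nonneg fun i _ => hn i
  have := inf_nsmul_add_le hc ht h0 N fun i hi =>
    Finset.single_le_sum (f := fun i : ℕ => (s - i • c)⁺ ⊓ (i • c - t)⁺)
      (fun i _ => hn i) (Finset.mem_range.2 hi)
  rw [inf_eq_left.2 (hs.trans (le_add_of_nonneg_right h0))] at this
  rw [sub_le_iff_le_add]
  refine this.trans (le_of_eq ?_)
  abel

/-- The parts of the increments of an increasing sequence lying across a fixed level are
disjoint. -/
theorem isDisjointFamily_level {x : ℕ → X} (hx : Monotone x) (l : X) :
    IsDisjointFamily fun n => (x (n + 1) - l)⁺ ⊓ (l - x n)⁺ := by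
  have hn : ∀ n, 0 ≤ (x (n + 1) - l)⁺ ⊓ (l - x n)⁺ := fun n =>
    le_inf (posPart_nonneg _) (posPart_nonneg _)
  have key : ∀ n m, n < m →
      ((x (n + 1) - l)⁺ ⊓ (l - x n)⁺) ⊓ ((x (m + 1) - l)⁺ ⊓ (l - x m)⁺) = 0 := by
    intro n m hnm
    refine le_antisymm ?_ (le_inf (hn n) (hn m))
    refine (inf_le_inf (inf_le_left.trans (posPart_mono (sub_le_sub_right (hx hnm) l)))
      inf_le_right).trans ?_
    have := posPart_inf_negPart_eq_zero (x m - l)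
    rw [← posPart_neg, neg_sub] at this
    exact this.le
  intro n m hnm
  simp only [abs_of_nonneg (hn _)]
  rcases hnm.lt_or_gt with h | h
  · exact key n m h
  · rw [inf_comm]; exact key m n h

end LatticeGroup

section MonotoneSequences

variable {E : Type u} [NormedAddCommGroup E] [NormedSpace ℝ E] [Lattice E]
  [IsOrderedAddMonoid E] [HasSolidNorm E] [IsOrderedModule ℝ E]

theorem tendsto_norm_sub_of_monotone {e : E} (he : 0 ≤ e)
    (hd : ∀ y : ℕ → E, (∀ n, y n ∈ Icc 0 e) → IsDisjointFamily y → Tendsto y atTop (𝓝 0))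
    {x : ℕ → E} (hx : Monotone x) (hxe : ∀ n, x n ∈ Icc 0 e) :
    Tendsto (fun n => ‖x (n + 1) - x n‖) atTop (𝓝 0) := by
  rw [Metric.tendsto_atTop]
  intro ε hε
  obtain ⟨N, hN⟩ := exists_nat_gt (‖e‖ / (ε / 2))
  have hN0 : (0 : ℝ) < N := lt_of_le_of_lt (by positivity) hN
  set c : E := (N : ℝ)⁻¹ • e with hc
  have hc0 : 0 ≤ c := smul_nonneg (by positivity) he
  have hce : N • c = e := by
    rw [hc, ← Nat.cast_smul_eq_nsmul ℝ, smul_smul, mul_inv_cancel₀ hN0.ne', one_smul]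
  have hcn : ‖c‖ < ε / 2 := by
    rw [hc, norm_smul, norm_inv, Real.norm_natCast, inv_mul_lt_iff₀ hN0]
    rwa [div_lt_iff₀ (by positivity)] at hN
  have hsum : Tendsto (fun n => ∑ i ∈ Finset.range N,
      (x (n + 1) - i • c)⁺ ⊓ (i • c - x n)⁺) atTop (𝓝 0) := by
    rw [← Finset.sum_const_zero (s := Finset.range N)]
    refine tendsto_finsetSum _ fun i _ => hd _ (fun n => ⟨le_inf (posPart_nonneg _)
      (posPart_nonneg _), inf_le_left.trans (sup_le ?_ he)⟩) (isDisjointFamily_level hx _)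
    exact (sub_le_self _ (nsmul_nonneg hc0 i)).trans (hxe (n + 1)).2
  have hsum2 := (hsum.add hsum).norm
  rw [add_zero, norm_zero] at hsum2
  obtain ⟨n₀, hn₀⟩ := (Metric.tendsto_atTop.1 hsum2) (ε / 2) (by positivity)
  refine ⟨n₀, fun n hn => ?_⟩
  have h1 := norm_le_norm_of_nonneg_of_le (sub_nonneg.2 (hx n.le_succ))
    (sub_le_add_sum_levels hc0 (hxe n).1 N (s := x (n + 1)) (by rw [hce]; exact (hxe _).2))
  have h2 := hn₀ n hn
  rw [Real.dist_eq, sub_zero, abs_norm] at h2 ⊢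
  exact h1.trans_lt ((norm_add_le _ _).trans_lt (by linarith))

theorem cauchySeq_of_monotone_of_disjoint {e : E} (he : 0 ≤ e)
    (hd : ∀ y : ℕ → E, (∀ n, y n ∈ Icc 0 e) → IsDisjointFamily y → Tendsto y atTop (𝓝 0))
    {x : ℕ → E} (hx : Monotone x) (hxe : ∀ n, x n ∈ Icc 0 e) : CauchySeq x := by
  rw [Metric.cauchySeq_iff']
  by_contra! hcon
  obtain ⟨ε, hε, h⟩ := hcon
  choose φ hφ1 hφ2 using h
  have hmono : Monotone fun k => φ^[k] 0 := monotone_nat_of_le_succ fun k => by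
    rw [Function.iterate_succ_apply']
    exact hφ1 _
  have := tendsto_norm_sub_of_monotone he hd (hx.comp hmono) fun n => hxe _
  obtain ⟨k, hk⟩ := (this.eventually_lt_const hε).exists
  have h2 := hφ2 (φ^[k] 0)
  rw [dist_eq_norm] at h2
  simp only [Function.comp_apply, Function.iterate_succ_apply'] at hk
  linarith

theorem cauchySeq_of_antitone_of_disjoint {e : E} (he : 0 ≤ e)
    (hd : ∀ y : ℕ → E, (∀ n, y n ∈ Icc 0 e) → IsDisjointFamily y → Tendsto y atTop (𝓝 0))
    {x : ℕ → E} (hx : Antitone x) (hxe : ∀ n, x n ∈ Icc 0 e) : CauchySeq x := by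
  have := cauchySeq_of_monotone_of_disjoint he hd (x := fun n => e - x n)
    (fun m n hmn => sub_le_sub_left (hx hmn) e)
    fun n => ⟨sub_nonneg.2 (hxe n).2, sub_le_self _ (hxe n).1⟩
  simpa [Function.comp_def] using
    (uniformContinuous_const.sub uniformContinuous_id).comp_cauchySeq (f := fun z => e - z) this

end MonotoneSequences

/-! ### Approximate order boundedness of norm bounded sets of functionals -/

section Dual

variable {E : Type u} [NormedAddCommGroup E] [NormedSpace ℝ E] [Lattice E]
  [IsOrderedAddMonoid E] [HasSolidNorm E] [IsOrderedModule ℝ E]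

theorem StrongDual.apply_nonneg {f : StrongDual ℝ E} (hf : 0 ≤ f) {x : E} (hx : 0 ≤ x) :
    0 ≤ f x := hf x hx

theorem StrongDual.apply_mono {f : StrongDual ℝ E} (hf : 0 ≤ f) {x y : E} (h : x ≤ y) :
    f x ≤ f y := by
  have := StrongDual.apply_nonneg hf (sub_nonneg.2 h)
  rw [map_sub] at this
  linarith

theorem StrongDual.apply_le_mul_of_norm_le {f : StrongDual ℝ E} {C : ℝ} (hf : ‖f‖ ≤ C) (x : E) :
    f x ≤ C * ‖x‖ :=
  (le_abs_self _).trans (f.le_of_opNorm_le hf x)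

theorem StrongDual.abs_apply_le_abs_apply_abs (f : StrongDual ℝ E) (x : E) :
    |f x| ≤ |f| |x| := by
  rw [abs_le']
  refine ⟨apply_le_abs_apply_abs f x, ?_⟩
  have := apply_le_abs_apply_abs f (-x)
  rwa [map_neg, abs_neg] at this

/-- If disjoint sequences in `[0, e]` are norm null, the positive functionals of norm at most `C`
are contained in an order interval `[0, g]` of the dual, up to an error `ε` uniform on `[0, e]`.

Otherwise there are functionals `f n` and vectors `a n ∈ [0, e]` such that `f n (a n) > ε`, while
the sum of `f k` over `k < n` is at most of order `2 ^ (-n)` at `a n`. The decreasing sequence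
`B n = sup_{m ≥ n} a m`, which exists because monotone sequences in `[0, e]` converge, has a limit
annihilated by all `f k`, and this is incompatible with `f n (B n) > ε`. -/
theorem exists_forall_apply_sub_le [CompleteSpace E] {e : E} (he : 0 ≤ e)
    (hd : ∀ y : ℕ → E, (∀ n, y n ∈ Icc 0 e) → IsDisjointFamily y → Tendsto y atTop (𝓝 0))
    (C : ℝ) {ε : ℝ} (hε : 0 < ε) :
    ∃ g : StrongDual ℝ E, 0 ≤ g ∧
      ∀ f : StrongDual ℝ E, 0 ≤ f → ‖f‖ ≤ C → ∀ a ∈ Icc 0 e, f a - g a ≤ ε := by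
  by_contra! hcon
  choose! Φ hΦ0 hΦC A hA hlt using hcon
  -- `G n` is the sum of the functionals `f k = Φ (2 ^ k • G k)` over `k < n`.
  obtain ⟨G, hG0, hGs⟩ : ∃ G : ℕ → StrongDual ℝ E,
      G 0 = 0 ∧ ∀ n, G (n + 1) = G n + Φ ((2 : ℝ) ^ n • G n) :=
    ⟨fun n => Nat.rec 0 (fun n g => g + Φ ((2 : ℝ) ^ n • g)) n, rfl, fun _ => rfl⟩
  have hGn : ∀ n, 0 ≤ G n := by
    intro n
    induction n with
    | zero => exact hG0.ge
    | succ n ih => rw [hGs]; exact add_nonneg ih (hΦ0 _ (smul_nonneg (by positivity) ih))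
  have hpos : ∀ n, 0 ≤ (2 : ℝ) ^ n • G n := fun n => smul_nonneg (by positivity) (hGn n)
  have hGmono : Monotone G := monotone_nat_of_le_succ fun n => by
    rw [hGs]; exact le_add_of_nonneg_right (hΦ0 _ (hpos n))
  set a : ℕ → E := fun n => A ((2 : ℝ) ^ n • G n)
  have hae : ∀ n, a n ∈ Icc 0 e := fun n => hA _ (hpos n)
  have hC : 0 ≤ C := (norm_nonneg _).trans (hΦC _ (hpos 0))
  set M := C * ‖e‖
  have hM0 : 0 ≤ M := by positivity
  have hsmall : ∀ n, G n (a n) ≤ (1 / 2) ^ n * M := by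
    intro n
    have h1 := hlt _ (hpos n)
    have h2 : Φ ((2 : ℝ) ^ n • G n) (a n) ≤ M :=
      (StrongDual.apply_le_mul_of_norm_le (hΦC _ (hpos n)) _).trans
        (mul_le_mul_of_nonneg_left (norm_le_norm_of_nonneg_of_le (hae n).1 (hae n).2) hC)
    have h3 : (2 : ℝ) ^ n * G n (a n) ≤ M := by
      change ε < _ - (2 : ℝ) ^ n * G n (a n) at h1
      linarith
    rw [one_div, inv_pow, ← div_eq_inv_mul, le_div_iff₀ (by positivity)]
    linarith
  have hlarge : ∀ n, ε < Φ ((2 : ℝ) ^ n • G n) (a n) := by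
    intro n
    have h1 := hlt _ (hpos n)
    have h2 := StrongDual.apply_nonneg (hpos n) (hae n).1
    linarith
  -- The tail suprema `B n` of the sequence `a`.
  have hbe : ∀ n m, partialSups (fun k => a (n + k)) m ∈ Icc 0 e := fun n m =>
    ⟨(hae n).1.trans (le_partialSups_of_le (fun k => a (n + k)) (Nat.zero_le m)),
      partialSups_le _ _ _ fun j _ => (hae _).2⟩
  have hconv : ∀ n, ∃ z, Tendsto (fun m => partialSups (fun k => a (n + k)) m) atTop (𝓝 z) :=
    fun n => cauchySeq_tendsto_of_complete
      (cauchySeq_of_monotone_of_disjoint he hd (partialSups _).monotone (hbe n))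
  choose B hB using hconv
  have hBe : ∀ n, B n ∈ Icc 0 e := fun n => isClosed_Icc.mem_of_tendsto (hB n)
    (Eventually.of_forall (hbe n))
  have haB : ∀ n, a n ≤ B n := fun n => ge_of_tendsto' (hB n) fun m =>
    le_partialSups_of_le (fun k => a (n + k)) (Nat.zero_le m)
  have hBanti : Antitone B := antitone_nat_of_succ_le fun n =>
    le_of_tendsto_of_tendsto' (hB (n + 1)) ((tendsto_add_atTop_iff_nat 1).2 (hB n)) fun m =>
      partialSups_le _ _ _ fun j hj => by
        have := le_partialSups_of_le (fun k => a (n + k)) (Nat.succ_le_succ hj)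
        rwa [show n + j.succ = n + 1 + j by omega] at this
  obtain ⟨b, hb⟩ := cauchySeq_tendsto_of_complete
    (cauchySeq_of_antitone_of_disjoint he hd hBanti hBe)
  have hGB : ∀ k n, k ≤ n → G k (B n) ≤ 2 * (1 / 2) ^ n * M := by
    intro k n hkn
    refine le_of_tendsto' (((G k).continuous.tendsto _).comp (hB n)) fun m => ?_
    have h1 : partialSups (fun k => a (n + k)) m ≤ ∑ i ∈ Finset.range (m + 1), a (n + i) :=
      partialSups_le _ _ _ fun j hj => Finset.single_le_sum (f := fun i => a (n + i))
        (fun i _ => (hae _).1) (Finset.mem_range.2 (Nat.lt_succ_of_le hj))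
    calc G k (partialSups (fun k => a (n + k)) m)
        ≤ ∑ i ∈ Finset.range (m + 1), G k (a (n + i)) := by
          rw [← map_sum]; exact StrongDual.apply_mono (hGn k) h1
      _ ≤ ∑ i ∈ Finset.range (m + 1), (1 / 2 : ℝ) ^ i * ((1 / 2) ^ n * M) := by
          refine Finset.sum_le_sum fun i _ => ?_
          refine ((hGmono (show k ≤ n + i by omega)) _ (hae _).1).trans ((hsmall _).trans ?_)
          rw [pow_add]; exact le_of_eq (by ring)
      _ = (∑ i ∈ Finset.range (m + 1), (1 / 2 : ℝ) ^ i) * ((1 / 2) ^ n * M) := by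
          rw [Finset.sum_mul]
      _ ≤ 2 * ((1 / 2) ^ n * M) :=
          mul_le_mul_of_nonneg_right (sum_geometric_two_le _) (by positivity)
      _ = 2 * (1 / 2) ^ n * M := by ring
  have hGb : ∀ k, G k b ≤ 0 := by
    intro k
    have h1 : Tendsto (fun n : ℕ => 2 * (1 / 2 : ℝ) ^ n * M) atTop (𝓝 0) := by
      have := ((tendsto_pow_atTop_nhds_zero_of_lt_one (r := (1 / 2 : ℝ)) (by norm_num)
        (by norm_num)).const_mul 2).mul_const M
      simpa using this
    exact le_of_tendsto_of_tendsto (((G k).continuous.tendsto _).comp hb) h1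
      ((eventually_ge_atTop k).mono fun n hn => hGB k n hn)
  have hb0 : 0 ≤ b := ge_of_tendsto' hb fun n => (hBe n).1
  have hlim : Tendsto (fun n => C * ‖B n - b‖) atTop (𝓝 0) := by
    have := ((hb.sub_const b).norm).const_mul C
    simpa using this
  obtain ⟨n, hn⟩ := (hlim.eventually_lt_const hε).exists
  have h1 : Φ ((2 : ℝ) ^ n • G n) b ≤ 0 := by
    have h2 := hGb (n + 1)
    rw [hGs] at h2
    change G n b + Φ ((2 : ℝ) ^ n • G n) b ≤ 0 at h2
    linarith [StrongDual.apply_nonneg (hGn n) hb0]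
  have h2 := StrongDual.apply_le_mul_of_norm_le (hΦC _ (hpos n)) (B n - b)
  rw [map_sub] at h2
  have h3 := StrongDual.apply_mono (hΦ0 _ (hpos n)) (haB n)
  linarith [hlarge n]

/-- If disjoint sequences in `[0, |x|]` are norm null, evaluation at `x` is continuous along norm
bounded unbounded absolutely weak* null nets: `|f|` is split as `|f| ⊓ g + (|f| - g)⁺`. -/
theorem tendsto_apply_of_uawStarConverges [CompleteSpace E] {x : E}
    (hd : ∀ y : ℕ → E, (∀ n, y n ∈ Icc 0 |x|) → IsDisjointFamily y → Tendsto y atTop (𝓝 0))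
    {ι : Type v} [Preorder ι] {f : ι → StrongDual ℝ E} (hf : IsNormBoundedFamily f)
    (hf0 : UawStarConverges f 0) : Tendsto (fun i => f i x) atTop (𝓝 0) := by
  obtain ⟨C, hC⟩ := hf
  rw [Metric.tendsto_nhds]
  intro ε hε
  obtain ⟨g, hg0, hg⟩ := exists_forall_apply_sub_le (abs_nonneg x) hd C (half_pos hε)
  have h1 := (tendsto_iff_forall_eval_tendsto_topDualPairing.1 (hf0 g hg0)) |x|
  have h1' : Tendsto (fun i => (|f i - 0| ⊓ g) |x|) atTop (𝓝 0) := h1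
  filter_upwards [h1'.eventually_lt_const (half_pos hε)] with i hi
  rw [sub_zero] at hi
  have h2 : |f i| |x| = (|f i| ⊓ g) |x| + (|f i| - g).rkPosPart |x| := by
    change _ = (|f i| |x| - (|f i| - g).rkPosPart |x|) + _
    ring
  have h3 : (|f i| - g).rkPosPart |x| ≤ ε / 2 := by
    rw [StrongDual.rkPosPart_apply _ (abs_nonneg x)]
    exact rieszKantorovich_le _ (abs_nonneg x) fun y hy =>
      hg _ (abs_nonneg _) ((norm_abs_eq_norm (f i)).trans_le (hC i)) y hy
  rw [Real.dist_eq, sub_zero]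
  linarith [StrongDual.abs_apply_le_abs_apply_abs (f i) x]

end Dual

/-! ### Positive functionals carried by an element -/

section Dual

variable {E : Type u} [NormedAddCommGroup E] [NormedSpace ℝ E] [Lattice E]
  [IsOrderedAddMonoid E] [HasSolidNorm E] [IsOrderedModule ℝ E]

/-- A bounded additive function on the positive cone extends to a positive functional. -/
theorem exists_strongDual_of_add_of_nonneg (p : E → ℝ) (C : ℝ)
    (hadd : ∀ z w : E, 0 ≤ z → 0 ≤ w → p (z + w) = p z + p w) (h0 : ∀ z, 0 ≤ z → 0 ≤ p z)
    (hC : ∀ z, 0 ≤ z → p z ≤ C * ‖z‖) :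
    ∃ g : StrongDual ℝ E, 0 ≤ g ∧ ∀ z, 0 ≤ z → g z = p z := by
  have hp0 : p 0 = 0 := by
    have := hadd 0 0 le_rfl le_rfl
    rw [add_zero] at this
    linarith
  let φ : E →+ ℝ :=
    { toFun := fun z => p z⁺ - p z⁻
      map_zero' := by simp
      map_add' := fun z w => by
        have h : (z + w)⁺ + (z⁻ + w⁻) = (z⁺ + w⁺) + (z + w)⁻ := by
          rw [← sub_eq_sub_iff_add_eq_add, posPart_sub_negPart, add_sub_add_comm,
            posPart_sub_negPart, posPart_sub_negPart]
        have := congrArg p h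
        rw [hadd _ _ (posPart_nonneg _) (add_nonneg (negPart_nonneg z) (negPart_nonneg w)),
          hadd _ _ (negPart_nonneg _) (negPart_nonneg _),
          hadd _ _ (add_nonneg (posPart_nonneg z) (posPart_nonneg w)) (negPart_nonneg _),
          hadd _ _ (posPart_nonneg _) (posPart_nonneg _)] at this
        linarith }
  have hφ : ∀ z, 0 ≤ z → φ z = p z := fun z hz => by
    change p z⁺ - p z⁻ = p z
    rw [posPart_of_nonneg hz, negPart_of_nonneg hz, hp0, sub_zero]
  have hmono : ∀ z w, 0 ≤ z → z ≤ w → p z ≤ p w := fun z w hz hzw => by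
    have := hadd z (w - z) hz (sub_nonneg.2 hzw)
    rw [add_sub_cancel] at this
    linarith [h0 _ (sub_nonneg.2 hzw)]
  have hcont : Continuous φ := by
    refine AddMonoidHomClass.continuous_of_bound φ C fun z => ?_
    have hz := hC _ (abs_nonneg z)
    rw [norm_abs_eq_norm] at hz
    have h1 := hmono _ _ (posPart_nonneg z) (le_add_of_nonneg_right (negPart_nonneg z))
    have h2 := hmono _ _ (negPart_nonneg z) (le_add_of_nonneg_left (posPart_nonneg z))
    rw [posPart_add_negPart] at h1 h2
    have h3 := h0 _ (posPart_nonneg z)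
    have h4 := h0 _ (negPart_nonneg z)
    change |p z⁺ - p z⁻| ≤ _
    rw [abs_le]
    constructor <;> linarith
  exact ⟨φ.toRealLinearMap hcont, fun z hz => (h0 z hz).trans_eq (hφ z hz).symm, hφ⟩

/-- A net of functionals decreasing to `0` in the order of the dual decreases to `0` pointwise on
the positive cone, since its pointwise infimum is again a functional. -/
theorem tendsto_apply_of_antitone_of_isGLB {β : Type v} [Preorder β] [IsDirectedOrder β]
    [Nonempty β] {y : β → StrongDual ℝ E} (hy : Antitone y) (hglb : IsGLB (range y) 0)
    {z : E} (hz : 0 ≤ z) : Tendsto (fun b => y b z) atTop (𝓝 0) := by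
  have hy0 : ∀ b, 0 ≤ y b := fun b => hglb.1 (mem_range_self b)
  have hbdd : ∀ z : E, 0 ≤ z → BddBelow (range fun b => y b z) := fun z hz =>
    ⟨0, by rintro _ ⟨b, rfl⟩; exact StrongDual.apply_nonneg (hy0 b) hz⟩
  have hlim : ∀ z : E, 0 ≤ z → Tendsto (fun b => y b z) atTop (𝓝 (⨅ b, y b z)) := fun z hz =>
    tendsto_atTop_ciInf (fun b c hbc => hy hbc z hz) (hbdd z hz)
  obtain ⟨b₀⟩ := ‹Nonempty β›
  obtain ⟨g, hg0, hg⟩ := exists_strongDual_of_add_of_nonneg (fun z => ⨅ b, y b z) ‖y b₀‖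
    (fun z w hz hw => tendsto_nhds_unique (hlim _ (add_nonneg hz hw)) (by
      simpa only [map_add] using (hlim z hz).add (hlim w hw)))
    (fun z hz => ge_of_tendsto' (hlim z hz) fun b => StrongDual.apply_nonneg (hy0 b) hz)
    (fun z hz => (ciInf_le (hbdd z hz) b₀).trans (StrongDual.apply_le_mul_of_norm_le le_rfl z))
  have hg' : g ≤ 0 := hglb.2 (by
    rintro _ ⟨b, rfl⟩ w hw
    rw [hg w hw]
    exact ciInf_le (hbdd w hw) b)
  have h := hlim z hz
  rwa [← hg z hz, le_antisymm hg' hg0] at h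

/-- The component of a positive functional `f` carried by `y ≥ 0`: it agrees with `f` on the
ideal generated by `y` and vanishes on the disjoint complement of `y`. -/
theorem exists_carried_component {f : StrongDual ℝ E} (hf : 0 ≤ f) {y : E} (hy : 0 ≤ y) :
    ∃ g : StrongDual ℝ E, 0 ≤ g ∧ g ≤ f ∧
      ∀ z, 0 ≤ z → Tendsto (fun k : ℕ => f (z ⊓ k • y)) atTop (𝓝 (g z)) := by
  have hle : ∀ z (k : ℕ), f (z ⊓ k • y) ≤ f z := fun z k => StrongDual.apply_mono hf inf_le_left
  have hbdd : ∀ z : E, BddAbove (range fun k : ℕ => f (z ⊓ k • y)) := fun z =>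
    ⟨f z, by rintro _ ⟨k, rfl⟩; exact hle z k⟩
  have hlim : ∀ z : E,
      Tendsto (fun k : ℕ => f (z ⊓ k • y)) atTop (𝓝 (⨆ k : ℕ, f (z ⊓ k • y))) := fun z =>
    tendsto_atTop_ciSup (fun k l hkl => StrongDual.apply_mono hf
      (inf_le_inf_left z (nsmul_le_nsmul_left hy hkl))) (hbdd z)
  have hsup : ∀ z, ⨆ k : ℕ, f (z ⊓ k • y) ≤ f z := fun z => ciSup_le (hle z)
  obtain ⟨g, hg0, hg⟩ := exists_strongDual_of_add_of_nonneg (fun z => ⨆ k : ℕ, f (z ⊓ k • y)) ‖f‖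
    (fun z w hz hw => le_antisymm
      (le_of_tendsto_of_tendsto' (hlim _) ((hlim z).add (hlim w)) fun k => by
        rw [← map_add]
        refine StrongDual.apply_mono hf ?_
        rw [inf_comm, inf_comm z, inf_comm w]
        exact inf_add_le_add_inf hz hw (nsmul_nonneg hy k))
      (le_of_tendsto_of_tendsto' ((hlim z).add (hlim w))
        ((hlim (z + w)).comp (tendsto_atTop_mono (fun k : ℕ => Nat.le_add_left k k) tendsto_id))
        fun k => by
          change _ ≤ f ((z + w) ⊓ (k + k) • y)
          rw [← map_add]
          refine StrongDual.apply_mono hf (le_inf (add_le_add inf_le_left inf_le_left) ?_)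
          rw [add_nsmul]
          exact add_le_add inf_le_right inf_le_right))
    (fun z hz => ge_of_tendsto' (hlim z) fun k =>
      StrongDual.apply_nonneg hf (le_inf hz (nsmul_nonneg hy k)))
    (fun z hz => (hsup z).trans (StrongDual.apply_le_mul_of_norm_le le_rfl z))
  refine ⟨g, hg0, fun z hz => (hg z hz).trans_le (hsup z), fun z hz => ?_⟩
  rw [hg z hz]
  exact hlim z

theorem carried_apply_eq_zero {f g : StrongDual ℝ E} {y z : E} (hy : 0 ≤ y) (hz : 0 ≤ z)
    (hg : Tendsto (fun k : ℕ => f (z ⊓ k • y)) atTop (𝓝 (g z))) (h : z ⊓ y = 0) : g z = 0 := by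
  simp only [inf_nsmul_eq_zero hz hy h, map_zero] at hg
  exact tendsto_nhds_unique hg tendsto_const_nhds

theorem carried_apply_eq {f g : StrongDual ℝ E} {y z : E} (hy : 0 ≤ y)
    (hg : Tendsto (fun k : ℕ => f (z ⊓ k • y)) atTop (𝓝 (g z))) {m : ℕ} (h : z ≤ m • y) :
    g z = f z := by
  refine tendsto_nhds_unique hg (tendsto_const_nhds.congr' ?_)
  filter_upwards [eventually_ge_atTop m] with k hk
  rw [inf_eq_left.2 (h.trans (nsmul_le_nsmul_left hy hk))]

theorem StrongDual.inf_apply_le (g h : StrongDual ℝ E) {a z : E} (ha : a ∈ Icc 0 z) :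
    (g ⊓ h) z ≤ g (z - a) + h a := by
  have h1 := (inf_le_left : g ⊓ h ≤ g) (z - a) (sub_nonneg.2 ha.2)
  have h2 := (inf_le_right : g ⊓ h ≤ h) a ha.1
  rw [map_sub] at h1
  linarith

/-- Functionals carried by disjoint elements are disjoint. -/
theorem inf_carried_eq_zero {f f' g g' : StrongDual ℝ E} (hg0 : 0 ≤ g) (hg0' : 0 ≤ g')
    {y y' : E} (hy : 0 ≤ y) (hy' : 0 ≤ y')
    (hg : ∀ z, 0 ≤ z → Tendsto (fun k : ℕ => f (z ⊓ k • y)) atTop (𝓝 (g z)))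
    (hg' : ∀ z, 0 ≤ z → Tendsto (fun k : ℕ => f' (z ⊓ k • y')) atTop (𝓝 (g' z)))
    (h : y ⊓ y' = 0) : g ⊓ g' = 0 := by
  refine le_antisymm (fun z hz => ?_) (le_inf hg0 hg0')
  have hk : ∀ k : ℕ, (g ⊓ g') z ≤ g z - f (z ⊓ k • y) := by
    intro k
    have ha : z ⊓ k • y ∈ Icc 0 z := ⟨le_inf hz (nsmul_nonneg hy k), inf_le_left⟩
    have h1 := StrongDual.inf_apply_le g g' ha
    have h2 : (z ⊓ k • y) ⊓ y' = 0 := by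
      refine le_antisymm ?_ (le_inf ha.1 hy')
      refine (inf_le_inf_right y' inf_le_right).trans ?_
      rw [inf_comm] at h ⊢
      exact (inf_nsmul_eq_zero hy' hy h k).le
    rw [carried_apply_eq_zero hy' ha.1 (hg' _ ha.1) h2, map_sub,
      carried_apply_eq hy (hg _ ha.1) inf_le_right] at h1
    linarith
  have := ge_of_tendsto' ((hg z hz).const_sub (g z)) hk
  simpa using this

/-- A disjoint sequence `y` in `[0, x⁺]` is norm null if bounded disjoint sequences of functionals
are null at `x`: norming functionals of `y n`, cut down to the part carried by `y n`, are disjoint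
and do not see `x⁻`. -/
theorem tendsto_zero_of_mem_Icc_posPart {x : E}
    (h : ∀ f : ℕ → StrongDual ℝ E, IsNormBoundedFamily f → IsDisjointFamily f →
      Tendsto (fun n => f n x) atTop (𝓝 0))
    {y : ℕ → E} (hy : ∀ n, y n ∈ Icc 0 x⁺) (hd : IsDisjointFamily y) :
    Tendsto y atTop (𝓝 0) := by
  have hex : ∀ n, ∃ f : StrongDual ℝ E, 0 ≤ f ∧ ‖f‖ ≤ 1 ∧ ‖y n‖ ≤ f (y n) := by
    intro n
    obtain ⟨f, hf1, hf2⟩ := exists_dual_vector'' ℝ (y n)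
    refine ⟨|f|, abs_nonneg f, (norm_abs_eq_norm f).trans_le hf1, ?_⟩
    have := le_abs_self f _ (hy n).1
    rw [hf2] at this
    exact this
  choose f hf0 hf1 hfy using hex
  choose g hg0 hgf hg using fun n => exists_carried_component (hf0 n) (hy n).1
  have hgx : ∀ n, ‖y n‖ ≤ g n x := by
    intro n
    have hneg : x⁻ ⊓ y n = 0 := by
      refine le_antisymm ?_ (le_inf (negPart_nonneg x) (hy n).1)
      refine (inf_le_inf_left _ (hy n).2).trans ?_
      rw [inf_comm, posPart_inf_negPart_eq_zero]
    have h1 := carried_apply_eq_zero (hy n).1 (negPart_nonneg x) (hg n _ (negPart_nonneg x)) hneg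
    have h2 := StrongDual.apply_mono (hg0 n) (hy n).2
    rw [carried_apply_eq (hy n).1 (hg n _ (hy n).1) (m := 1) (by rw [one_smul])] at h2
    rw [← posPart_sub_negPart x, map_sub, h1, sub_zero]
    exact (hfy n).trans h2
  have hlim := h g ⟨1, fun n => ?_⟩ fun m n hmn => ?_
  · exact squeeze_zero_norm hgx hlim
  · refine (HasSolidNorm.solid ?_ : ‖g n‖ ≤ ‖f n‖).trans (hf1 n)
    rw [abs_of_nonneg (hg0 n), abs_of_nonneg (hf0 n)]
    exact hgf n
  · change |g m| ⊓ |g n| = 0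
    rw [abs_of_nonneg (hg0 m), abs_of_nonneg (hg0 n)]
    refine inf_carried_eq_zero (hg0 m) (hg0 n) (hy m).1 (hy n).1 (hg m) (hg n) ?_
    have : |y m| ⊓ |y n| = 0 := hd hmn
    rwa [abs_of_nonneg (hy m).1, abs_of_nonneg (hy n).1] at this

theorem isDisjointFamily_inf_right {y : ℕ → E} (hy : ∀ n, 0 ≤ y n) (hd : IsDisjointFamily y)
    {w : E} (hw : 0 ≤ w) : IsDisjointFamily fun n => y n ⊓ w := by
  intro m n hmn
  have := hd.abs_inf hw hmn
  simp only [abs_of_nonneg (hy _)] at this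
  simpa only [abs_of_nonneg (le_inf (hy _) hw)] using this

theorem tendsto_zero_of_forall_disjoint_functionals {x : E}
    (h : ∀ f : ℕ → StrongDual ℝ E, IsNormBoundedFamily f → IsDisjointFamily f →
      Tendsto (fun n => f n x) atTop (𝓝 0))
    {y : ℕ → E} (hy : ∀ n, y n ∈ Icc 0 |x|) (hd : IsDisjointFamily y) :
    Tendsto y atTop (𝓝 0) := by
  have h1 := tendsto_zero_of_mem_Icc_posPart h
    (fun n => ⟨le_inf (hy n).1 (posPart_nonneg x), inf_le_right⟩)
    (isDisjointFamily_inf_right (fun n => (hy n).1) hd (posPart_nonneg x))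
  have h2 := tendsto_zero_of_mem_Icc_posPart (x := -x) (y := fun n => y n ⊓ x⁻)
    (fun f hf hfd => by simpa using (h f hf hfd).neg)
    (fun n => ⟨le_inf (hy n).1 (negPart_nonneg x), by rw [posPart_neg]; exact inf_le_right⟩)
    (isDisjointFamily_inf_right (fun n => (hy n).1) hd (negPart_nonneg x))
  have h3 := (h1.add h2).norm
  rw [add_zero, norm_zero] at h3
  refine squeeze_zero_norm (fun n => norm_le_norm_of_nonneg_of_le (hy n).1 ?_) h3
  refine le_trans ?_ (inf_add_le_add_inf (posPart_nonneg x) (negPart_nonneg x) (hy n).1)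
  rw [posPart_add_negPart]
  exact le_inf le_rfl (hy n).2

end Dual

/-! ### Comparison of the unbounded convergences -/

section BanachLattice

variable {X : Type u} [NormedAddCommGroup X] [NormedSpace ℝ X] [Lattice X]
  [IsOrderedAddMonoid X] [HasSolidNorm X] [IsOrderedModule ℝ X]

theorem nonpos_of_forall_nsmul_le {z w : X} (h : ∀ k : ℕ, k • z ≤ w) : z ≤ 0 := by
  have hlim : Tendsto (fun k : ℕ => ((k : ℝ) + 1)⁻¹ • w) atTop (𝓝 0) := by
    have h0 : Tendsto (fun k : ℕ => ((k : ℝ) + 1)⁻¹) atTop (𝓝 0) := by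
      simpa using tendsto_one_div_add_atTop_nhds_zero_nat (𝕜 := ℝ)
    simpa using h0.smul_const w
  refine ge_of_tendsto' hlim fun k => ?_
  have hk : (0 : ℝ) < (k : ℝ) + 1 := by positivity
  have := smul_le_smul_of_nonneg_left (h (k + 1)) (inv_nonneg.2 hk.le)
  rwa [← Nat.cast_smul_eq_nsmul ℝ, smul_smul, Nat.cast_add_one, inv_mul_cancel₀ hk.ne',
    one_smul] at this

/-- A disjoint sequence is uo-null. For `w ≥ 0` the partial sums `S n` of `|x n| ⊓ w` are bounded
by `w`, and the differences `U - S n`, with `U` an upper bound of all partial sums, decrease to `0`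
because the order is Archimedean. No supremum of the `S n` is needed. -/
theorem IsDisjointFamily.uoConverges {x : ℕ → X} (hd : IsDisjointFamily x) :
    UoConverges x 0 := by
  intro w hw
  set g : ℕ → X := fun n => |x n| ⊓ w
  have hg : ∀ n, 0 ≤ g n := fun n => le_inf (abs_nonneg _) hw
  set S : ℕ → X := fun n => ∑ i ∈ Finset.range n, g i with hS
  have hSmono : Monotone S := monotone_nat_of_le_succ fun n => by
    rw [hS]; simp only [Finset.sum_range_succ]; exact le_add_of_nonneg_right (hg n)
  have hSw : ∀ n, S n ≤ w := fun n =>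
    sum_le_of_pairwise_inf_eq_zero hg (hd.abs_inf hw) hw _ fun i _ => inf_le_right
  refine ⟨{U : X // ∀ n, S n ≤ U}ᵒᵈ × ℕ, inferInstance, ⟨fun a b => ?_⟩,
    ⟨(OrderDual.toDual ⟨w, hSw⟩, 0)⟩, fun b => (OrderDual.ofDual b.1).1 - S b.2,
    fun a b hab => sub_le_sub hab.1 (hSmono hab.2), ⟨?_, ?_⟩, fun b => ⟨b.2, fun i hi => ?_⟩⟩
  · exact ⟨(OrderDual.toDual ⟨(OrderDual.ofDual a.1).1 ⊓ (OrderDual.ofDual b.1).1, fun n =>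
      le_inf ((OrderDual.ofDual a.1).2 n) ((OrderDual.ofDual b.1).2 n)⟩, max a.2 b.2),
      ⟨(inf_le_left : (OrderDual.ofDual a.1).1 ⊓ (OrderDual.ofDual b.1).1 ≤ _), le_max_left _ _⟩,
      ⟨(inf_le_right : (OrderDual.ofDual a.1).1 ⊓ (OrderDual.ofDual b.1).1 ≤ _),
        le_max_right _ _⟩⟩
  · rintro _ ⟨b, rfl⟩
    exact sub_nonneg.2 ((OrderDual.ofDual b.1).2 b.2)
  · intro z hz
    -- Subtracting a lower bound `z` from an upper bound of the partial sums gives another one.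
    have hk : ∀ k n : ℕ, S n ≤ w - k • z := by
      intro k
      induction k with
      | zero => simpa using hSw
      | succ k ih =>
        intro n
        have : z ≤ w - k • z - S n :=
          hz (mem_range_self (⟨OrderDual.toDual ⟨w - k • z, ih⟩, n⟩ :
            {U : X // ∀ n, S n ≤ U}ᵒᵈ × ℕ))
        rw [succ_nsmul, ← sub_sub]
        exact le_sub_comm.1 this
    refine nonpos_of_forall_nsmul_le (w := w) fun k => ?_
    have h0 : S 0 = 0 := Finset.sum_range_zero _
    have := hk k 0
    rw [h0] at this
    exact sub_nonneg.1 this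
  · simp only [sub_zero]
    change |g i| ≤ _
    rw [abs_of_nonneg (hg i), le_sub_iff_add_le, add_comm]
    have h1 : S (i + 1) = S i + g i := Finset.sum_range_succ _ _
    exact (add_le_add_left (hSmono hi) (g i)).trans
      (h1.symm.le.trans ((OrderDual.ofDual b.1).2 (i + 1)))

/-- A disjoint net over an index set without maximal elements is uaw-null: a positive functional
is at least `ε` on only finitely many terms of a disjoint family bounded by `w`. -/
theorem IsDisjointFamily.uawConverges {ι : Type v} [Preorder ι] [IsDirectedOrder ι] [Nonempty ι]
    [NoMaxOrder ι] {x : ι → X} (hd : IsDisjointFamily x) : UawConverges x 0 := by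
  intro w hw
  have hg : ∀ i, 0 ≤ |x i| ⊓ w := fun i => le_inf (abs_nonneg _) hw
  have hinj : Function.Injective (topDualPairing ℝ X).flip := fun a b hab =>
    (SeparatingDual.eq_iff_forall_dual_eq (R := ℝ)).2 fun φ => LinearMap.congr_fun hab φ
  refine (WeakBilin.tendsto_iff_forall_eval_tendsto _ hinj).2 fun φ => ?_
  simp only [sub_zero]
  change Tendsto (fun i => φ (|x i| ⊓ w)) atTop (𝓝 (φ 0))
  rw [map_zero, Metric.tendsto_nhds]
  intro ε hε
  have hfin : {i | ε ≤ |φ| (|x i| ⊓ w)}.Finite := by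
    by_contra hinf
    obtain ⟨N, hN⟩ := exists_nat_gt (|φ| w / ε)
    obtain ⟨s, hs, hcard⟩ := Set.Infinite.exists_subset_card_eq hinf N
    have h1 := StrongDual.apply_mono (abs_nonneg φ)
      (sum_le_of_pairwise_inf_eq_zero hg (hd.abs_inf hw) hw s fun i _ => inf_le_right)
    rw [map_sum] at h1
    have h2 := s.card_nsmul_le_sum (fun i => |φ| (|x i| ⊓ w)) ε fun i hi => hs hi
    rw [hcard, nsmul_eq_mul] at h2
    rw [div_lt_iff₀ hε] at hN
    linarith
  obtain ⟨i₀, hi₀⟩ := hfin.bddAbove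
  obtain ⟨i₁, hi₁⟩ := exists_gt i₀
  filter_upwards [eventually_ge_atTop i₁] with i hi
  rw [Real.dist_eq, sub_zero]
  refine (StrongDual.abs_apply_le_abs_apply_abs φ _).trans_lt ?_
  rw [abs_of_nonneg (hg i)]
  by_contra! hcon
  exact (hi₁.trans_le (hi.trans (hi₀ hcon))).false

theorem UoConverges.unConverges {ι : Type v} [Preorder ι] [IsDirectedOrder ι] [Nonempty ι]
    (hX : OrderContinuousNorm X) {x : ι → X} (hx : UoConverges x 0) : UnConverges x 0 := by
  intro w hw
  obtain ⟨β, _, _, _, y, hy, hglb, hb⟩ := hx w hw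
  rw [Metric.tendsto_nhds]
  intro ε hε
  obtain ⟨b, hbε⟩ := ((hX β y hy hglb).eventually_lt_const hε).exists
  obtain ⟨i₀, hi₀⟩ := hb b
  filter_upwards [eventually_ge_atTop i₀] with i hi
  have h := hi₀ i hi
  rw [sub_zero (|x i - 0| ⊓ w)] at h
  rw [dist_zero_right, ← norm_abs_eq_norm]
  exact (norm_le_norm_of_nonneg_of_le (abs_nonneg _) h).trans_lt hbε

end BanachLattice

section Dual

variable {E : Type u} [NormedAddCommGroup E] [NormedSpace ℝ E] [Lattice E]
  [IsOrderedAddMonoid E] [HasSolidNorm E] [IsOrderedModule ℝ E]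
  {ι : Type v} [Preorder ι] {f : ι → StrongDual ℝ E}

theorem uawStarConverges_zero_iff : UawStarConverges f 0 ↔
    ∀ w : StrongDual ℝ E, 0 ≤ w → ∀ z, Tendsto (fun i => (|f i| ⊓ w) z) atTop (𝓝 0) := by
  refine forall₂_congr fun w _ => ?_
  rw [tendsto_iff_forall_eval_tendsto_topDualPairing]
  simp only [sub_zero]
  rfl

theorem UawConverges.uawStarConverges (hf : UawConverges f 0) : UawStarConverges f 0 := by
  rw [uawStarConverges_zero_iff]
  intro w hw z
  have h := ((WeakBilin.eval_continuous (topDualPairing ℝ (StrongDual ℝ E)).flip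
    (evalFunctional z)).tendsto 0).comp (hf w hw)
  have h0 : (topDualPairing ℝ (StrongDual ℝ E)).flip 0 (evalFunctional z) = 0 := by
    rw [map_zero, LinearMap.zero_apply]
  simp only [sub_zero] at h
  exact h0 ▸ h

theorem UnConverges.uawStarConverges (hf : UnConverges f 0) : UawStarConverges f 0 := by
  rw [uawStarConverges_zero_iff]
  intro w hw z
  have h := ((evalFunctional z).continuous.tendsto 0).comp (hf w hw)
  rw [map_zero] at h
  simp only [sub_zero] at h
  exact h

theorem UoConverges.uawStarConverges (hf : UoConverges f 0) : UawStarConverges f 0 := by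
  rw [uawStarConverges_zero_iff]
  intro w hw
  have key : ∀ z : E, 0 ≤ z → Tendsto (fun i => (|f i| ⊓ w) z) atTop (𝓝 0) := by
    intro z hz
    obtain ⟨β, _, _, _, y, hy, hglb, hb⟩ := hf w hw
    rw [Metric.tendsto_nhds]
    intro ε hε
    obtain ⟨b, hbε⟩ :=
      ((tendsto_apply_of_antitone_of_isGLB hy hglb hz).eventually_lt_const hε).exists
    obtain ⟨i₀, hi₀⟩ := hb b
    filter_upwards [eventually_ge_atTop i₀] with i hi
    have h0 : 0 ≤ |f i| ⊓ w := le_inf (abs_nonneg _) hw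
    have h := hi₀ i hi
    simp only [sub_zero] at h
    rw [abs_of_nonneg h0] at h
    rw [Real.dist_eq, sub_zero, abs_of_nonneg (StrongDual.apply_nonneg h0 hz)]
    exact (h z hz).trans_lt hbε
  intro z
  have h := (key _ (posPart_nonneg z)).sub (key _ (negPart_nonneg z))
  simpa only [← map_sub, posPart_sub_negPart, sub_zero] using h

end Dual

/-! ### From nets to sequences -/

section ULift

theorem tendsto_down_atTop : Tendsto (ULift.down : ULift.{v} ℕ → ℕ) atTop atTop :=
  tendsto_atTop.2 fun n => (eventually_ge_atTop (ULift.up n)).mono fun _ h => h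

theorem tendsto_up_atTop : Tendsto (ULift.up : ℕ → ULift.{v} ℕ) atTop atTop :=
  tendsto_atTop.2 fun n => (eventually_ge_atTop n.down).mono fun _ h => h

theorem UoConverges.comp_down {X : Type u} [Lattice X] [AddCommGroup X] {x : ℕ → X}
    (hx : UoConverges x 0) :
    UoConverges (fun i : ULift.{v} ℕ => x i.down) 0 := fun w hw => by
  obtain ⟨β, i1, i2, i3, y, hy, hglb, hb⟩ := hx w hw
  refine ⟨β, i1, i2, i3, y, hy, hglb, fun b => ?_⟩
  obtain ⟨i₀, hi₀⟩ := hb b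
  exact ⟨⟨i₀⟩, fun i hi => hi₀ i.down hi⟩

instance ULift.instNoMaxOrderNat : NoMaxOrder (ULift.{v} ℕ) :=
  ⟨fun n => ⟨⟨n.down + 1⟩, Nat.lt_succ_self n.down⟩⟩

end ULift

/-! ### The equivalences -/

theorem mainTheorem4 {E : Type u} [NormedAddCommGroup E] [NormedSpace ℝ E] [CompleteSpace E]
    [Lattice E] [IsOrderedAddMonoid E] [IsOrderedModule ℝ E] [HasSolidNorm E] (x : E) :
    [evalFunctional x ∈ uawStarDual.{u, v} E,
      ∀ f : ℕ → StrongDual ℝ E, IsNormBoundedFamily f → UawStarConverges f 0 →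
        Tendsto (fun n => evalFunctional x (f n)) atTop (𝓝 0),
      (evalFunctional x : StrongDual ℝ E →ₗ[ℝ] ℝ) ∈ uoDual.{u, v} (StrongDual ℝ E),
      ∀ f : ℕ → StrongDual ℝ E, IsNormBoundedFamily f → UoConverges f 0 →
        Tendsto (fun n => evalFunctional x (f n)) atTop (𝓝 0),
      evalFunctional x ∈ uawDual.{u, v} (StrongDual ℝ E),
      ∀ f : ℕ → StrongDual ℝ E, IsNormBoundedFamily f → UawConverges f 0 →
        Tendsto (fun n => evalFunctional x (f n)) atTop (𝓝 0),
      evalFunctional x ∈ disjointDual.{u, v} (StrongDual ℝ E),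
      ∀ f : ℕ → StrongDual ℝ E, IsNormBoundedFamily f → IsDisjointFamily f →
        Tendsto (fun n => evalFunctional x (f n)) atTop (𝓝 0),
      ∀ y : ℕ → E, (∀ n, y n ∈ Icc 0 |x|) → IsDisjointFamily y → Tendsto y atTop (𝓝 0)].TFAE ∧
    (OrderContinuousNorm (StrongDual ℝ E) →
      [∀ y : ℕ → E, (∀ n, y n ∈ Icc 0 |x|) → IsDisjointFamily y → Tendsto y atTop (𝓝 0),
        evalFunctional x ∈ unDual.{u, v} (StrongDual ℝ E),
        ∀ f : ℕ → StrongDual ℝ E, IsNormBoundedFamily f → UnConverges f 0 →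
          Tendsto (fun n => evalFunctional x (f n)) atTop (𝓝 0)].TFAE) := by
  have bdd : ∀ {f : ℕ → StrongDual ℝ E}, IsNormBoundedFamily f →
      IsNormBoundedFamily fun i : ULift.{v} ℕ => f i.down := fun ⟨C, hC⟩ => ⟨C, fun i => hC _⟩
  constructor
  · tfae_have 1 → 2 := fun h f hf hf0 =>
      (h (ULift ℕ) _ (bdd hf) fun w hw => (hf0 w hw).comp tendsto_down_atTop).comp tendsto_up_atTop
    tfae_have 2 → 6 := fun h f hf hf0 => h f hf hf0.uawStarConverges
    tfae_have 6 → 8 := fun h f hf hf0 => h f hf hf0.uawConverges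
    tfae_have 8 → 9 := fun h y hy hd => tendsto_zero_of_forall_disjoint_functionals h hy hd
    tfae_have 9 → 1 := fun h ι _ _ _ f hf hf0 => tendsto_apply_of_uawStarConverges h hf hf0
    tfae_have 1 → 3 := fun h ι _ _ _ f hf hf0 => h ι f hf hf0.uawStarConverges
    tfae_have 3 → 4 := fun h f hf hf0 =>
      (h (ULift ℕ) _ (bdd hf) hf0.comp_down).comp tendsto_up_atTop
    tfae_have 4 → 8 := fun h f hf hf0 => h f hf hf0.uoConverges
    tfae_have 1 → 5 := fun h ι _ _ _ f hf hf0 => h ι f hf hf0.uawStarConverges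
    tfae_have 5 → 7 := fun h ι _ _ _ _ f hf hf0 => h ι f hf hf0.uawConverges
    tfae_have 7 → 8 := fun h f hf hf0 =>
      (h (ULift ℕ) _ (bdd hf) fun i j hij => hf0 fun hd => hij (ULift.down_injective hd)).comp
        tendsto_up_atTop
    tfae_finish
  · intro hE
    tfae_have 1 → 2 := fun h ι _ _ _ f hf hf0 =>
      tendsto_apply_of_uawStarConverges h hf hf0.uawStarConverges
    tfae_have 2 → 3 := fun h f hf hf0 =>
      (h (ULift ℕ) _ (bdd hf) fun w hw => (hf0 w hw).comp tendsto_down_atTop).comp tendsto_up_atTop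
    tfae_have 3 → 1 := fun h y hy hd => tendsto_zero_of_forall_disjoint_functionals
      (fun f hf hf0 => h f hf (hf0.uoConverges.unConverges hE)) hy hd
    tfae_finish
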